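/- Let $[u]$ be an entire odd function of one complex variable, not identically zero, satisfying $$[x+u][x-u][y+v][y-v]-[x+v][x-v][y+u][y-u]=[x+y][x-y][u+v][u-v]$$ for all $x,y,u,v\in\mathbb{C}$ (for example $[u]=e^{2\pi\sqrt{-1}\,au^2}\sigma(u;\Omega)$ with $a\in\mathbb{C}$ and $\sigma(u;\Omega)$ the Weierstrass sigma function of a period lattice $\Omega$), and let $\delta\in\mathbb{C}$ be such that $[k\delta]\neq 0$ for every nonzero integer $k$. Write $[u]_k=[u][u+\delta]\cdots[u+(k-1)\delta]$ and $[u\pm v]=[u+v][u-v]$. For $\alpha\in\mathbb{N}^m$, $x=(x_1,\ldots,x_m)$ and $u=(u_1,\ldots,u_l)$ put $$\Phi_\alpha(x|u)=\sum_{0\le\mu\le\alpha}\ \prod_{i=1}^m\frac{[2x_i+2\mu_i\delta]}{[2x_i]}\prod_{1\le i<j\le m}\frac{[(x_i+\mu_i\delta)\pm(x_j+\mu_j\delta)]}{[x_i\pm x_j]}\prod_{1\le i,j\le m}\frac{[x_i+x_j]_{\mu_i}[x_i-x_j-\alpha_j\delta]_{\mu_i}}{[x_i+x_j+(\alpha_j+1)\delta]_{\mu_i}[x_i-x_j+\delta]_{\mu_i}}\prod_{\substack{1\le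 i\le m\\1\le k\le l}}\frac{[x_i+u_k]_{\mu_i}}{[x_i-u_k+\delta]_{\mu_i}},$$ where the sum is over all $\mu\in\mathbb{N}^m$ with $0\le\mu_i\le\alpha_i$ for all $i$. Let $m,n\ge 0$ be integers and let $\alpha\in\mathbb{N}^m$ and $\beta\in\mathbb{N}^n$ be multi-indices with $|\alpha|=|\beta|+1$, where $|\alpha|=\sum_i\alpha_i$ and $|\beta|=\sum_k\beta_k$. Then $$\Phi_\alpha\Bigl(x\,\Big|\,\bigl(\tfrac{\delta}{2}+y_k+\beta_k\delta,\ \tfrac{\delta}{2}-y_k\bigr)_{1\le k\le n}\Bigr)=0$$ for all $x\in\mathbb{C}^m$ and $y\in\mathbb{C}^n$ at which none of the denominators in this sum vanishes. -/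

import Mathlib

open Finset

/-- A bracket function `u ↦ [u]`: a not identically zero, odd, entire function satisfying
`[x ± u][y ± v] - [x ± v][y ± u] = [x ± y][u ± v]`, where `[x ± y] = [x + y][x - y]`. -/
structure IsBracket (f : ℂ → ℂ) : Prop where
  entire : Differentiable ℂ f
  odd : ∀ u, f (-u) = -f u
  ne_zero : ∃ u, f u ≠ 0
  riemann : ∀ x y u v : ℂ,
    (f (x + u) * f (x - u)) * (f (y + v) * f (y - v))
      - (f (x + v) * f (x - v)) * (f (y + u) * f (y - u))
      = (f (x + y) * f (x - y)) * (f (u + v) * f (u - v))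

/-- The shifted factorial `[u]_k = [u][u + δ] ⋯ [u + (k - 1)δ]`. -/
def shiftedFactorial (f : ℂ → ℂ) (δ u : ℂ) (k : ℕ) : ℂ :=
  ∏ r ∈ range k, f (u + r * δ)

/-- The multiple series of type `C`, `Φ_α(x | u)`: the sum over all multi-indices
`0 ≤ μ ≤ α`. The parameters `u` are indexed by any finite type, as their order is
immaterial. -/
noncomputable def Phi (f : ℂ → ℂ) (δ : ℂ) {m : ℕ} {κ : Type*} [Fintype κ]
    (α : Fin m → ℕ) (x : Fin m → ℂ) (u : κ → ℂ) : ℂ :=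
  ∑ μ ∈ Icc (0 : Fin m → ℕ) α,
    (∏ i, f (2 * x i + 2 * μ i * δ) / f (2 * x i))
    * (∏ i, ∏ j ∈ Ioi i,
        (f ((x i + μ i * δ) + (x j + μ j * δ)) * f ((x i + μ i * δ) - (x j + μ j * δ)))
          / (f (x i + x j) * f (x i - x j)))
    * (∏ i, ∏ j,
        (shiftedFactorial f δ (x i + x j) (μ i)
            * shiftedFactorial f δ (x i - x j - α j * δ) (μ i))
          / (shiftedFactorial f δ (x i + x j + (α j + 1) * δ) (μ i)
            * shiftedFactorial f δ (x i - x j + δ) (μ i)))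
    * (∏ i, ∏ k,
        shiftedFactorial f δ (x i + u k) (μ i) / shiftedFactorial f δ (x i - u k + δ) (μ i))

/-- None of the denominators in the terms of `Φ_α(x | u)` vanishes, i.e. `(x, u)` is not on one
of the apparent polar divisors. (A zero of `[v]_k` is also one of `[v]_l` for all `l ≥ k`, so
only `k = α_i` has to be mentioned.) -/
structure PhiDenomsNeZero (f : ℂ → ℂ) (δ : ℂ) {m : ℕ} {κ : Type*}
    (α : Fin m → ℕ) (x : Fin m → ℂ) (u : κ → ℂ) : Prop where
  two_mul : ∀ i, f (2 * x i) ≠ 0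
  add : ∀ i j, i < j → f (x i + x j) ≠ 0
  sub : ∀ i j, i < j → f (x i - x j) ≠ 0
  add_shift : ∀ i j, shiftedFactorial f δ (x i + x j + (α j + 1) * δ) (α i) ≠ 0
  sub_shift : ∀ i j, shiftedFactorial f δ (x i - x j + δ) (α i) ≠ 0
  param : ∀ i k, shiftedFactorial f δ (x i - u k + δ) (α i) ≠ 0

/-- The parameters `(δ/2 + y_k + β_k δ, δ/2 - y_k)` for `1 ≤ k ≤ n`. -/
noncomputable def pairedParams (δ : ℂ) {n : ℕ} (β : Fin n → ℕ) (y : Fin n → ℂ) :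
    Fin n ⊕ Fin n → ℂ :=
  Sum.elim (fun k => δ / 2 + y k + β k * δ) (fun k => δ / 2 - y k)

/-! The vanishing is a specialization of a source identity: for `|S| = |Y| + 1`, the sum over all
choices of signs `z_a = ±X_a` of the sign product times `∏_{a<b} [z_a+z_b-δ]/[z_a+z_b] · ∏_{a,y}
[z_a+δ/2±y]` is zero (`IsBracket.sum_powerset_pairProd_mul_crossProd`). It is proved by induction on
`Y`. By the Riemann relation the sum is, in one `y`, a polynomial of degree at most `|S|` in a
suitable coordinate (`IsBracket.sum_prod_eq_zero_of_forall_mem`), and at `|S| + 1` values of `y` it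
collapses to the identity with one index removed.

Now let `X` run through the strings `x_i + (s+1/2)δ`, `s < α_i`, and `Y` through `y_k + (t+1/2)δ`,
`t < β_k`. Only those sign choices survive whose plus signs form an initial segment of length `μ_i`
in each string. Divided by the term `μ = 0`, the products telescope to the terms of `Phi`
(`IsBracket.pairProd_range_eq`, `IsBracket.pairBlock_eq`, `IsBracket.crossBlock_eq`). This settles
generic `x`; the other points follow by continuity along a line. -/

namespace IsBracket

/-! ### Zeros of the bracket and interpolation in one variable. -/

variable {f : ℂ → ℂ}

lemma map_zero (hf : IsBracket f) : f 0 = 0 := by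
  have := hf.odd 0
  rw [neg_zero] at this
  exact self_eq_neg.mp this

lemma sub_comm (hf : IsBracket f) (a b : ℂ) : f (a - b) = -f (b - a) := by
  rw [← hf.odd, neg_sub]

/-- The zeros of a nonzero entire function form a closed discrete set, and ℂ is Lindelöf. -/
lemma countable_zeros (hf : IsBracket f) : (f ⁻¹' {0}).Countable := by
  obtain ⟨u, hu⟩ := hf.ne_zero
  have hana : AnalyticOnNhd ℂ f Set.univ := fun z _ => hf.entire.analyticAt z
  have hmem : (f ⁻¹' {0})ᶜ ∈ Filter.codiscrete ℂ :=
    hana.preimage_zero_mem_codiscreteWithin hu (Set.mem_univ u) isConnected_univ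
  have hd : IsDiscrete (f ⁻¹' {0}) := by simpa using (mem_codiscrete'.mp hmem).2
  have hc : IsClosed (f ⁻¹' {0}) := isClosed_singleton.preimage hf.entire.continuous
  exact hc.isLindelof.countable hd.to_subtype

/-- Each nonconstant affine condition excludes countably many `t`, and a countable set has dense
complement in ℂ. This supplies both the auxiliary points of the interpolation and the generic points
of the final limit. -/
lemma dense_forall_ne_zero (hf : IsBracket f) {ι : Type*} [Countable ι]
    (c w : ι → ℂ) (hw : ∀ i, w i ≠ 0) : Dense {t : ℂ | ∀ i, f (c i + w i * t) ≠ 0} := by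
  have h : {t : ℂ | ∀ i, f (c i + w i * t) ≠ 0}
      = (⋃ i, (fun t => c i + w i * t) ⁻¹' (f ⁻¹' {0}))ᶜ := by
    ext t; simp
  rw [h]
  refine Set.Countable.dense_compl ℂ (Set.countable_iUnion fun i => ?_)
  refine hf.countable_zeros.preimage_of_injOn ?_
  intro s _ t _ hst
  simpa [hw i] using hst

/-- A linear combination of products `∏ [w_a ± p]` is, up to a common factor, a polynomial of
degree at most the number of factors in `[p ± a] / [p ± b]`. -/
lemma sum_prod_eq_zero_of_forall_mem (hf : IsBracket f) {ι κ : Type*}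
    (s : Finset ι) (J : Finset κ)
    (C : κ → ℂ) (w : κ → ι → ℂ) (P : Finset ℂ) (hP : s.card < P.card)
    (hPP : ∀ p ∈ P, ∀ q ∈ P, p ≠ q → f (p + q) * f (p - q) ≠ 0)
    (hzero : ∀ p ∈ P, ∑ A ∈ J, C A * ∏ a ∈ s, (f (w A a + p) * f (w A a - p)) = 0) (y : ℂ) :
    ∑ A ∈ J, C A * ∏ a ∈ s, (f (w A a + y) * f (w A a - y)) = 0 := by
  classical
  -- The auxiliary `b` keeps the coordinate `t p = [p±a]/[p±b]` finite at `y` and at all nodes; `a`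
  -- is then chosen with `[a±b] ≠ 0`.
  obtain ⟨b, hb⟩ : ∃ b, ∀ i : {p // p ∈ insert y P} × Bool,
      f ((i.1 : ℂ) + (if i.2 then 1 else -1) * b) ≠ 0 :=
    (hf.dense_forall_ne_zero (fun i : {p // p ∈ insert y P} × Bool => (i.1 : ℂ))
      (fun i => if i.2 then 1 else -1) (fun i => by split_ifs <;> norm_num)).nonempty
  obtain ⟨a, ha⟩ : ∃ a, ∀ i : Bool, f ((if i then 1 else -1) * b + 1 * a) ≠ 0 :=
    (hf.dense_forall_ne_zero (fun i : Bool => (if i then 1 else -1) * b)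
      (fun _ => 1) (fun i => one_ne_zero)).nonempty
  have hab : f (a + b) * f (a - b) ≠ 0 := by
    refine mul_ne_zero ?_ ?_
    · have := ha true; simpa [add_comm] using this
    · have := ha false; simpa [add_comm, sub_eq_add_neg] using this
  have hpb : ∀ p ∈ insert y P, f (p + b) * f (p - b) ≠ 0 := by
    intro p hp
    refine mul_ne_zero ?_ ?_
    · have := hb (⟨p, hp⟩, true); simpa using this
    · have := hb (⟨p, hp⟩, false); simpa [sub_eq_add_neg] using this
  set t : ℂ → ℂ := fun p => f (p + a) * f (p - a) / (f (p + b) * f (p - b)) with ht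
  set Q : Polynomial ℂ := ∑ A ∈ J, Polynomial.C (C A) * ∏ i ∈ s,
    (Polynomial.C (f (w A i + a) * f (w A i - a))
      - Polynomial.C (f (w A i + b) * f (w A i - b)) * Polynomial.X) with hQ
  -- By the Riemann relation each `[v±p]` is linear in `t p`, up to a factor that depends on `p`
  -- alone.
  have hlin : ∀ v, ∀ p ∈ insert y P,
      f (v + a) * f (v - a) - f (v + b) * f (v - b) * t p
        = f (v + p) * f (v - p) * (f (a + b) * f (a - b) / (f (p + b) * f (p - b))) := by
    intro v p hp
    have h0 := hpb p hp
    have h1 := hf.riemann v p a b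
    simp only [ht]
    rw [mul_div_assoc', mul_div_assoc', ← h1, eq_div_iff h0, sub_mul, div_mul_cancel₀ _ h0]
  have hev : ∀ p ∈ insert y P, Q.eval (t p)
      = (∑ A ∈ J, C A * ∏ i ∈ s, (f (w A i + p) * f (w A i - p)))
        * (f (a + b) * f (a - b) / (f (p + b) * f (p - b))) ^ s.card := by
    intro p hp
    simp only [hQ, Polynomial.eval_finsetSum, Polynomial.eval_mul, Polynomial.eval_prod,
      Polynomial.eval_sub, Polynomial.eval_C, Polynomial.eval_X]
    rw [sum_mul]
    refine sum_congr rfl fun A _ => ?_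
    rw [mul_assoc, prod_congr rfl fun i _ => hlin (w A i) p hp, prod_mul_distrib, prod_const]
  have hdeg : Q.natDegree ≤ s.card := by
    refine Polynomial.natDegree_sum_le_of_forall_le _ _ fun A _ => ?_
    refine (Polynomial.natDegree_C_mul_le _ _).trans ?_
    refine (Polynomial.natDegree_prod_le _ _).trans ?_
    refine (sum_le_card_nsmul _ _ 1 fun i _ => ?_).trans (by simp)
    compute_degree
  -- The same relation turns `t p = t q` into `[p±q][a±b] = 0`.
  have hinj : Set.InjOn t P := by
    intro p hp q hq hpq
    by_contra hne
    have h0 := hpb p (mem_insert_of_mem hp)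
    have h1 := hpb q (mem_insert_of_mem hq)
    have h2 := hf.riemann p q a b
    simp only [ht] at hpq
    rw [div_eq_div_iff h0 h1] at hpq
    rw [hpq, mul_comm (f (q + a) * f (q - a)), sub_self] at h2
    exact mul_ne_zero (hPP p hp q hq hne) hab h2.symm
  have hQ0 : Q = 0 := by
    refine Polynomial.eq_zero_of_natDegree_lt_card_of_eval_eq_zero' Q (P.image t) ?_ ?_
    · intro r hr
      obtain ⟨p, hp, rfl⟩ := mem_image.mp hr
      rw [hev p (mem_insert_of_mem hp), hzero p hp, zero_mul]
    · rw [card_image_of_injOn hinj]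
      omega
  have := hev y (mem_insert_self y P)
  rw [hQ0, Polynomial.eval_zero, zero_eq_mul] at this
  exact this.resolve_right (pow_ne_zero _ (div_ne_zero hab (hpb y (mem_insert_self y P))))

end IsBracket

/-! ### The source identity. -/

/-- The point with coordinates `X a` for `a ∈ A` and `-X a` for `a ∉ A`. -/
noncomputable def signed {ι : Type*} [DecidableEq ι] (X : ι → ℂ) (A : Finset ι) (a : ι) : ℂ :=
  if a ∈ A then X a else -X a

/-- The product of `[z_a + z_b - δ] / [z_a + z_b]` over all pairs `a < b` in `S`. -/
noncomputable def pairProd (f : ℂ → ℂ) (δ : ℂ) {ι : Type*} [LinearOrder ι] (S : Finset ι)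
    (z : ι → ℂ) : ℂ :=
  ∏ a ∈ S, ∏ b ∈ S with a < b, f (z a + z b - δ) / f (z a + z b)

/-- The product of `[z_a + δ/2 ± y]` over all `a ∈ S` and `y ∈ Y`. -/
noncomputable def crossProd (f : ℂ → ℂ) (δ : ℂ) {ι : Type*} (S : Finset ι) (Y : Multiset ℂ)
    (z : ι → ℂ) : ℂ :=
  ∏ a ∈ S, (Y.map fun y => f (z a + δ / 2 + y) * f (z a + δ / 2 - y)).prod

section

variable {f : ℂ → ℂ} {δ : ℂ} {ι : Type*} [LinearOrder ι]

lemma signed_insert_of_ne (X : ι → ℂ) (A : Finset ι) {a c : ι} (h : a ≠ c) :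
    signed X (insert c A) a = signed X A a := by
  simp [signed, h]

lemma pairProd_congr (S : Finset ι) {z w : ι → ℂ} (h : ∀ a ∈ S, z a = w a) :
    pairProd f δ S z = pairProd f δ S w := by
  refine prod_congr rfl fun a ha => prod_congr rfl fun b hb => ?_
  rw [h a ha, h b (mem_filter.mp hb).1]

omit [LinearOrder ι] in
lemma crossProd_congr (S : Finset ι) (Y : Multiset ℂ) {z w : ι → ℂ} (h : ∀ a ∈ S, z a = w a) :
    crossProd f δ S Y z = crossProd f δ S Y w := by
  refine prod_congr rfl fun a ha => ?_
  rw [h a ha]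

/-- The factor of a pair is symmetric, so `c` may sit anywhere in the order. -/
lemma pairProd_insert (S : Finset ι) {c : ι} (hc : c ∉ S) (z : ι → ℂ) :
    pairProd f δ (insert c S) z
      = pairProd f δ S z * ∏ b ∈ S, f (z b + z c - δ) / f (z b + z c) := by
  unfold pairProd
  rw [prod_insert hc, filter_insert, if_neg (lt_irrefl c), mul_comm]
  have h : ∀ a ∈ S, ∏ b ∈ insert c S with a < b, f (z a + z b - δ) / f (z a + z b)
      = (∏ b ∈ S with a < b, f (z a + z b - δ) / f (z a + z b))
        * if a < c then f (z a + z c - δ) / f (z a + z c) else 1 := by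
    intro a _
    rw [filter_insert]
    split_ifs with h
    · rw [prod_insert (by simp [hc]), mul_comm]
    · rw [mul_one]
  rw [prod_congr rfl h, prod_mul_distrib, mul_assoc, prod_filter, ← prod_mul_distrib]
  congr 1
  refine prod_congr rfl fun b hb => ?_
  rcases lt_trichotomy b c with h | h | h
  · simp [h, h.not_gt]
  · exact absurd (h ▸ hb) hc
  · simp [h, h.not_gt, add_comm (z c)]

omit [LinearOrder ι] in
lemma crossProd_cons (S : Finset ι) (Y : Multiset ℂ) (y : ℂ) (z : ι → ℂ) :
    crossProd f δ S (y ::ₘ Y) z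
      = crossProd f δ S Y z * ∏ a ∈ S, (f (z a + δ / 2 + y) * f (z a + δ / 2 - y)) := by
  simp only [crossProd, Multiset.map_cons, Multiset.prod_cons]
  rw [prod_mul_distrib, mul_comm]

/-- At `y = ±(δ/2 - z_c)` the terms of the source identity with a fixed sign of `z_c` are those
with the index `c` removed, up to a common factor. -/
lemma IsBracket.pairProd_mul_crossProd_insert (hf : IsBracket f) (S A : Finset ι) (Y : Multiset ℂ)
    (X z : ι → ℂ) {c : ι} (hc : c ∉ S) (e y : ℂ) (hz : ∀ b ∈ S, z b = signed X A b) (hzc : z c = e)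
    (hy : y = δ / 2 - e ∨ y = -(δ / 2 - e))
    (hne : ∀ b ∈ S, f (z b + e) ≠ 0) :
    pairProd f δ (insert c S) z * crossProd f δ (insert c S) (y ::ₘ Y) z
      = pairProd f δ S (signed X A) * crossProd f δ S Y (signed X A)
        * ((Y.map fun y => f (e + δ / 2 + y) * f (e + δ / 2 - y)).prod
          * (f (e + δ / 2 + y) * f (e + δ / 2 - y))
          * ∏ b ∈ S, (f (X b + e - δ) * f (X b - e + δ))) := by
  -- For `y = ±(δ/2 - e)` one of the two new factors cancels the denominator `[z_b+e]`. What remains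
  -- is invariant under `z_b ↦ -z_b` because `f` is odd, hence does not depend on `A`.
  have key : ∀ b ∈ S, f (z b + e - δ) / f (z b + e)
      * (f (z b + δ / 2 + y) * f (z b + δ / 2 - y)) = f (X b + e - δ) * f (X b - e + δ) := by
    intro b hb
    have h1 : f (z b + δ / 2 + y) * f (z b + δ / 2 - y) = f (z b - e + δ) * f (z b + e) := by
      rcases hy with rfl | rfl
      · congr 2 <;> ring
      · rw [mul_comm]; congr 2 <;> ring
    rw [h1, div_mul_eq_mul_div, ← mul_assoc, mul_div_assoc, div_self (hne b hb), mul_one, hz b hb]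
    unfold signed
    split_ifs
    · rfl
    · rw [show -X b + e - δ = -(X b - e + δ) by ring, show -X b - e + δ = -(X b + e - δ) by ring,
        hf.odd, hf.odd]
      ring
  have hkey := prod_congr rfl key
  rw [prod_mul_distrib] at hkey
  rw [crossProd_cons, pairProd_insert S hc, prod_insert hc, hzc, ← hkey, ← pairProd_congr S hz,
    ← crossProd_congr S Y hz]
  rw [show crossProd f δ (insert c S) Y z
    = (Y.map fun y => f (e + δ / 2 + y) * f (e + δ / 2 - y)).prod * crossProd f δ S Y z by
      unfold crossProd; rw [prod_insert hc, hzc]]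
  ring

/-- The source identity, before the multiple principal specialization. -/
theorem IsBracket.sum_powerset_pairProd_mul_crossProd (hf : IsBracket f) (X : ι → ℂ)
    (Y : Multiset ℂ) (S : Finset ι) (hcard : S.card = Y.card + 1)
    (hadd : ∀ a ∈ S, ∀ b ∈ S, f (X a + X b) ≠ 0)
    (hsub : ∀ a ∈ S, ∀ b ∈ S, a ≠ b → f (X a - X b) ≠ 0)
    (hadd' : ∀ a ∈ S, ∀ b ∈ S, f (X a + X b + δ) ≠ 0)
    (hsub' : ∀ a ∈ S, ∀ b ∈ S, a ≤ b → f (X b - X a + δ) ≠ 0) :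
    ∑ A ∈ S.powerset,
      (-1) ^ A.card * (pairProd f δ S (signed X A) * crossProd f δ S Y (signed X A)) = 0 := by
  induction Y using Multiset.induction_on generalizing S with
  -- One index and no `y`: the two sign choices contribute `1` and `-1`.
  | empty =>
    obtain ⟨c, rfl⟩ := card_eq_one.mp (by simpa using hcard)
    rw [← insert_empty_eq, sum_powerset_insert (by simp)]
    simp [pairProd, crossProd, filter_singleton]
  | cons y Y ih =>
    rw [Multiset.card_cons] at hcard
    have hprod : ∀ y, ∑ A ∈ S.powerset, (-1) ^ A.card
          * (pairProd f δ S (signed X A) * crossProd f δ S (y ::ₘ Y) (signed X A))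
        = ∑ A ∈ S.powerset, ((-1) ^ A.card
          * (pairProd f δ S (signed X A) * crossProd f δ S Y (signed X A)))
          * ∏ a ∈ S, (f (signed X A a + δ / 2 + y) * f (signed X A a + δ / 2 - y)) := by
      intro y
      refine sum_congr rfl fun A _ => ?_
      rw [crossProd_cons]
      ring
    -- At each such `y` one sign of `z_c` produces a factor `[0]`. The terms with the other sign are
    -- a common multiple of those for `S` without `c`, to which the induction hypothesis applies.
    have hred : ∀ c ∈ S, ∀ y, (y = δ / 2 + X c ∨ y = -(δ / 2 - X c)) →
        ∑ A ∈ S.powerset, (-1) ^ A.card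
          * (pairProd f δ S (signed X A) * crossProd f δ S (y ::ₘ Y) (signed X A)) = 0 := by
      intro c hc y hy
      obtain ⟨T, hcT, rfl⟩ : ∃ T, c ∉ T ∧ insert c T = S :=
        ⟨S.erase c, notMem_erase c S, insert_erase hc⟩
      rw [card_insert_of_notMem hcT] at hcard
      have hT : ∑ A ∈ T.powerset, (-1) ^ A.card
          * (pairProd f δ T (signed X A) * crossProd f δ T Y (signed X A)) = 0 :=
        ih T (by omega)
          (fun a ha b hb => hadd a (mem_insert_of_mem ha) b (mem_insert_of_mem hb))
          (fun a ha b hb => hsub a (mem_insert_of_mem ha) b (mem_insert_of_mem hb))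
          (fun a ha b hb => hadd' a (mem_insert_of_mem ha) b (mem_insert_of_mem hb))
          (fun a ha b hb => hsub' a (mem_insert_of_mem ha) b (mem_insert_of_mem hb))
      have hbc : ∀ b ∈ T, b ≠ c := fun b hb h => hcT (h ▸ hb)
      have h1 : ∀ b ∈ T, f (X b + X c) ≠ 0 := fun b hb =>
        hadd b (mem_insert_of_mem hb) c hc
      have h2 : ∀ b ∈ T, f (X b - X c) ≠ 0 := fun b hb =>
        hsub b (mem_insert_of_mem hb) c hc (hbc b hb)
      have h3 : ∀ b ∈ T, f (-X b + X c) ≠ 0 := fun b hb => by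
        rw [show -X b + X c = -(X b - X c) by ring, hf.odd]; exact neg_ne_zero.mpr (h2 b hb)
      have h4 : ∀ b ∈ T, f (-X b - X c) ≠ 0 := fun b hb => by
        rw [show -X b - X c = -(X b + X c) by ring, hf.odd]; exact neg_ne_zero.mpr (h1 b hb)
      rw [sum_powerset_insert hcT]
      rcases hy with hy | hy
      · have hz : ∀ A ∈ T.powerset, crossProd f δ (insert c T) (y ::ₘ Y)
            (signed X (insert c A)) = 0 := by
          intro A hA
          rw [crossProd_cons, prod_insert hcT]
          have : signed X (insert c A) c + δ / 2 - y = 0 := by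
            rw [hy]; simp [signed, add_comm]
          rw [this, hf.map_zero]
          ring
        rw [sum_eq_zero (s := T.powerset) (f := fun A => (-1) ^ (insert c A).card
          * (pairProd f δ (insert c T) (signed X (insert c A))
            * crossProd f δ (insert c T) (y ::ₘ Y) (signed X (insert c A))))
          (fun A hA => by rw [hz A hA]; ring), add_zero]
        have hz' : ∀ A ∈ T.powerset, (-1) ^ A.card * (pairProd f δ (insert c T) (signed X A)
            * crossProd f δ (insert c T) (y ::ₘ Y) (signed X A))
            = (-1) ^ A.card * (pairProd f δ T (signed X A) * crossProd f δ T Y (signed X A))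
            * ((Y.map fun y => f (-X c + δ / 2 + y) * f (-X c + δ / 2 - y)).prod
              * (f (-X c + δ / 2 + y) * f (-X c + δ / 2 - y))
              * ∏ b ∈ T, (f (X b + -X c - δ) * f (X b - -X c + δ))) := by
          intro A hA
          have hcA : c ∉ A := fun h => hcT (mem_powerset.mp hA h)
          rw [hf.pairProd_mul_crossProd_insert T A Y X (signed X A) hcT (-X c) y (fun _ _ => rfl)
            (by simp [signed, hcA]) (Or.inl (by rw [hy]; ring)) ?_, ← mul_assoc]
          intro b hb
          unfold signed
          split_ifs
          · exact h2 b hb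
          · exact h4 b hb
        rw [sum_congr rfl hz', ← sum_mul, hT, zero_mul]
      · have hz : ∀ A ∈ T.powerset, crossProd f δ (insert c T) (y ::ₘ Y)
            (signed X A) = 0 := by
          intro A hA
          have hcA : c ∉ A := fun h => hcT (mem_powerset.mp hA h)
          rw [crossProd_cons, prod_insert hcT]
          have : signed X A c + δ / 2 + y = 0 := by
            rw [hy]; simp [signed, hcA]
          rw [this, hf.map_zero]
          ring
        rw [sum_eq_zero (s := T.powerset) (f := fun A => (-1) ^ A.card
          * (pairProd f δ (insert c T) (signed X A)
            * crossProd f δ (insert c T) (y ::ₘ Y) (signed X A)))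
          (fun A hA => by rw [hz A hA]; ring), zero_add]
        have hz' : ∀ A ∈ T.powerset, (-1) ^ (insert c A).card
            * (pairProd f δ (insert c T) (signed X (insert c A))
            * crossProd f δ (insert c T) (y ::ₘ Y) (signed X (insert c A)))
            = (-1) ^ A.card * (pairProd f δ T (signed X A) * crossProd f δ T Y (signed X A))
            * (-((Y.map fun y => f (X c + δ / 2 + y) * f (X c + δ / 2 - y)).prod
              * (f (X c + δ / 2 + y) * f (X c + δ / 2 - y))
              * ∏ b ∈ T, (f (X b + X c - δ) * f (X b - X c + δ)))) := by
          intro A hA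
          have hcA : c ∉ A := fun h => hcT (mem_powerset.mp hA h)
          rw [hf.pairProd_mul_crossProd_insert T A Y X (signed X (insert c A)) hcT (X c) y
            (fun b hb => signed_insert_of_ne X A (hbc b hb))
            (by simp [signed]) (Or.inr hy) ?_, card_insert_of_notMem hcA, pow_succ,
            mul_neg_one, neg_mul, ← mul_assoc, mul_neg]
          intro b hb
          rw [signed_insert_of_ne X A (hbc b hb)]
          unfold signed
          split_ifs
          · exact h1 b hb
          · exact h3 b hb
        rw [sum_congr rfl hz', ← sum_mul, hT, zero_mul]
    have hS : S.Nonempty := card_pos.mp (by omega)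
    -- Degree `|S|` calls for `|S| + 1` nodes: all `X_a + δ/2` and one extra `X_c - δ/2`. The latter
    -- must differ from the others through `[X_a - X_c + δ] ≠ 0`, which `hsub'` grants only for `c ≤
    -- a`; in a string the opposite difference of neighbours vanishes. Hence `c` is minimal.
    set c := S.min' hS
    have hc : c ∈ S := S.min'_mem hS
    have hXinj : Set.InjOn (fun a => X a + δ / 2) S := by
      intro a ha b hb hab
      by_contra hne
      refine hsub a ha b hb hne ?_
      have : X a = X b := by simpa using hab
      rw [this, sub_self, hf.map_zero]
    have hsubc : ∀ a ∈ S, f (X a - X c + δ) ≠ 0 := fun a ha => hsub' c hc a ha (S.min'_le a ha)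
    have hnot : X c - δ / 2 ∉ S.image fun a => X a + δ / 2 := by
      intro h
      obtain ⟨a, ha, hac⟩ := mem_image.mp h
      refine hsubc a ha ?_
      rw [show X a - X c + δ = (X a + δ / 2) - (X c - δ / 2) by ring, hac, sub_self, hf.map_zero]
    rw [hprod]
    refine hf.sum_prod_eq_zero_of_forall_mem S S.powerset _ (fun A a => signed X A a + δ / 2)
      (insert (X c - δ / 2) (S.image fun a => X a + δ / 2)) ?_ ?_ ?_ y
    · rw [card_insert_of_notMem hnot, card_image_of_injOn hXinj]
      omega
    · have hmain : ∀ a ∈ S, f (X a + δ / 2 + (X c - δ / 2)) * f (X a + δ / 2 - (X c - δ / 2)) ≠ 0 := by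
        intro a ha
        rw [show X a + δ / 2 + (X c - δ / 2) = X a + X c by ring,
          show X a + δ / 2 - (X c - δ / 2) = X a - X c + δ by ring]
        exact mul_ne_zero (hadd a ha c hc) (hsubc a ha)
      intro p hp q hq hpq
      rw [mem_insert, mem_image] at hp hq
      rcases hp with rfl | ⟨a, ha, rfl⟩ <;> rcases hq with rfl | ⟨b, hb, rfl⟩
      · exact absurd rfl hpq
      · rw [add_comm (X c - δ / 2), hf.sub_comm (X c - δ / 2), mul_neg]
        exact neg_ne_zero.mpr (hmain b hb)
      · exact hmain a ha
      · rw [show X a + δ / 2 + (X b + δ / 2) = X a + X b + δ by ring,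
          show X a + δ / 2 - (X b + δ / 2) = X a - X b by ring]
        exact mul_ne_zero (hadd' a ha b hb) (hsub a ha b hb fun h => hpq (by rw [h]))
    · intro p hp
      rw [← hprod]
      rw [mem_insert, mem_image] at hp
      rcases hp with rfl | ⟨a, ha, rfl⟩
      · exact hred c hc _ (Or.inr (by ring))
      · exact hred a ha _ (Or.inl (by ring))

end

/-! ### Specialization to strings: pairs of points in two different strings. -/

/-- The points `x + (s + 1/2) δ` for `s < p` and `-(x + (s + 1/2) δ)` for `s ≥ p`. -/
noncomputable def signedString (δ x : ℂ) (p s : ℕ) : ℂ :=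
  if s < p then x + (s + 1 / 2) * δ else -(x + (s + 1 / 2) * δ)

/-- The `(i, j)` factor of the third product in `Phi`. -/
noncomputable def shiftedRatio (f : ℂ → ℂ) (δ x y : ℂ) (b p : ℕ) : ℂ :=
  (shiftedFactorial f δ (x + y) p * shiftedFactorial f δ (x - y - b * δ) p)
    / (shiftedFactorial f δ (x + y + (b + 1) * δ) p * shiftedFactorial f δ (x - y + δ) p)

/-- The product of all factors of a term of `Phi` which involve two distinct indices. -/
noncomputable def pairTerm (f : ℂ → ℂ) (δ x y : ℂ) (a b p q : ℕ) : ℂ :=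
  (f ((x + p * δ) + (y + q * δ)) * f ((x + p * δ) - (y + q * δ))) / (f (x + y) * f (x - y))
    * (shiftedRatio f δ x y b p * shiftedRatio f δ y x a q)

/-- The product of `[z + w - δ] / [z + w]` over pairs of points in two signed strings. -/
noncomputable def pairBlock (f : ℂ → ℂ) (δ x y : ℂ) (a b p q : ℕ) : ℂ :=
  ∏ s ∈ range a, ∏ t ∈ range b,
    f (signedString δ x p s + signedString δ y q t - δ)
      / f (signedString δ x p s + signedString δ y q t)

section

variable {f : ℂ → ℂ} {δ x y : ℂ}

lemma ne_zero_of_eq_add {u : ℂ} (h : ∀ r : ℤ, f (u + r * δ) ≠ 0) (r : ℤ) {v : ℂ}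
    (hv : v = u + r * δ) : f v ≠ 0 :=
  hv ▸ h r

lemma shiftedFactorial_succ (u : ℂ) (k : ℕ) :
    shiftedFactorial f δ u (k + 1) = shiftedFactorial f δ u k * f (u + k * δ) :=
  prod_range_succ _ _

@[simp]
lemma shiftedFactorial_zero (u : ℂ) : shiftedFactorial f δ u 0 = 1 :=
  prod_range_zero _

lemma shiftedFactorial_ne_zero {u v : ℂ} (h : ∀ r : ℤ, f (u + r * δ) ≠ 0) (r : ℤ)
    (hv : v = u + r * δ) (k : ℕ) : shiftedFactorial f δ v k ≠ 0 :=
  prod_ne_zero_iff.mpr fun s _ => ne_zero_of_eq_add h (r + s) (by rw [hv]; push_cast; ring)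

lemma shiftedRatio_succ (b p : ℕ) :
    shiftedRatio f δ x y b (p + 1) = shiftedRatio f δ x y b p
      * ((f (x + y + p * δ) * f (x - y - b * δ + p * δ))
        / (f (x + y + (b + 1) * δ + p * δ) * f (x - y + δ + p * δ))) := by
  simp only [shiftedRatio, shiftedFactorial_succ]
  rw [div_mul_div_comm]
  congr 1 <;> ring

@[simp]
lemma shiftedRatio_zero (b : ℕ) : shiftedRatio f δ x y b 0 = 1 := by
  simp [shiftedRatio]

lemma prod_range_div_succ {h : ℕ → ℂ} (hne : ∀ t, h t ≠ 0) (n : ℕ) :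
    ∏ t ∈ range n, h (t + 1) / h t = h n / h 0 := by
  induction n with
  | zero => simp [hne]
  | succ n ih => rw [prod_range_succ, ih, mul_comm, div_mul_div_cancel₀ (hne n)]

lemma prod_range_div_succ' {h : ℕ → ℂ} {n : ℕ} (hne : ∀ t ≤ n, h t ≠ 0) :
    ∏ t ∈ range n, h t / h (t + 1) = h 0 / h n := by
  induction n with
  | zero => simp [hne]
  | succ n ih =>
    rw [prod_range_succ, ih fun t ht => hne t (by omega), div_mul_div_cancel₀ (hne n (by omega))]

lemma div_eq_neg_div_neg_mul {A B C D : ℂ} (hC : C ≠ 0) (hD : D ≠ 0) :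
    A / B = -C / -D * (A / C / (B / D)) := by
  field_simp

lemma div_eq_neg_div_neg_mul' {A B C D : ℂ} (hC : C ≠ 0) (hD : D ≠ 0) :
    A / B = -C / -D * (D / B / (C / A)) := by
  field_simp

lemma mul_eq_neg_mul_neg_mul {A B C D : ℂ} (hC : C ≠ 0) (hD : D ≠ 0) :
    A * B = -C * -D * (A / C / (D / B)) := by
  field_simp

/-- Two telescoping products meet at `q`, where the sign of the second string changes; the shift of
index there leaves the gap from `h q` to `h (q + 1)`. -/
lemma prod_range_ite_div {h : ℕ → ℂ} (hne : ∀ t, h t ≠ 0) {q b : ℕ} (hqb : q ≤ b) :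
    ∏ t ∈ range b, (if t < q then h t / h (t + 1) else h (t + 1) / h (t + 2))
      = h 0 / h q * (h (q + 1) / h (b + 1)) := by
  induction b, hqb using Nat.le_induction with
  | base =>
    rw [prod_congr rfl fun t ht => if_pos (mem_range.mp ht),
      prod_range_div_succ' fun t _ => hne t, div_self (hne _), mul_one]
  | succ b hqb ih =>
    rw [prod_range_succ, ih, if_neg (by omega)]
    have := hne (b + 1)
    field_simp

/-- Passing from `p` to `p + 1` flips the sign of the single point `x + (p+1/2)δ`. Its interaction
with the other string changes by ratios of consecutive values of `h`, so only boundary values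
survive. -/
lemma IsBracket.prod_flip (hf : IsBracket f) (hp : ∀ r : ℤ, f (x + y + r * δ) ≠ 0)
    (hm : ∀ r : ℤ, f (x - y + r * δ) ≠ 0) {b q : ℕ} (p : ℕ) (hqb : q ≤ b) :
    ∏ t ∈ range b, (f (x + (p + 1 / 2) * δ + signedString δ y q t - δ)
        / f (x + (p + 1 / 2) * δ + signedString δ y q t))
      = (∏ t ∈ range b, (f (-(x + (p + 1 / 2) * δ) + signedString δ y q t - δ)
        / f (-(x + (p + 1 / 2) * δ) + signedString δ y q t)))
      * (f (x + y + p * δ) / f (x - y + (p + 1) * δ)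
        * (f (x - y + (p - q + 1) * δ) / f (x + y + (p + q) * δ))
        * (f (x + y + (p + q + 1) * δ) / f (x - y + (p - q) * δ)
          * (f (x - y + (p - b) * δ) / f (x + y + (p + b + 1) * δ)))) := by
  set h : ℕ → ℂ := fun t => f (x + y + (p + t) * δ) / f (x - y + (p - t + 1) * δ) with hh
  have hp' : ∀ t : ℕ, f (x + y + (p + t) * δ) ≠ 0 := fun t =>
    ne_zero_of_eq_add hp (p + t) (by push_cast; ring)
  have hm' : ∀ t : ℕ, f (x - y + (p - t + 1) * δ) ≠ 0 := fun t =>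
    ne_zero_of_eq_add hm (p - t + 1) (by push_cast; ring)
  have hne : ∀ t, h t ≠ 0 := fun t => div_ne_zero (hp' t) (hm' t)
  have hR : (f (x + y + p * δ) / f (x - y + (p + 1) * δ)
        * (f (x - y + (p - q + 1) * δ) / f (x + y + (p + q) * δ))
        * (f (x + y + (p + q + 1) * δ) / f (x - y + (p - q) * δ)
          * (f (x - y + (p - b) * δ) / f (x + y + (p + b + 1) * δ))))
      = h 0 / h q * (h (q + 1) / h (b + 1)) := by
    simp only [hh, div_div_eq_mul_div, Nat.cast_zero, Nat.cast_add, Nat.cast_one, sub_zero,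
      add_zero, add_assoc, sub_add_eq_sub_sub, sub_add_cancel]
    simp only [div_eq_mul_inv]
    ring
  rw [hR, ← prod_range_ite_div hne hqb, ← prod_mul_distrib]
  refine prod_congr rfl fun t _ => ?_
  have e1 : ∀ u v : ℂ, u = -v → f u = -f v := fun u v h => by rw [h, hf.odd]
  have p0 := hp' t
  have p1 := hp' (t + 1)
  have p2 := hp' (t + 2)
  have m0 := hm' t
  have m1 := hm' (t + 1)
  have m2 := hm' (t + 2)
  unfold signedString
  split_ifs with htq
  · rw [show x + (p + 1 / 2) * δ + (y + (t + 1 / 2) * δ) - δ = x + y + (p + t) * δ by ring,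
      show x + (p + 1 / 2) * δ + (y + (t + 1 / 2) * δ) = x + y + (p + (t + 1 : ℕ)) * δ by
        push_cast; ring,
      e1 (-(x + (p + 1 / 2) * δ) + (y + (t + 1 / 2) * δ) - δ) (x - y + (p - t + 1) * δ) (by ring),
      e1 (-(x + (p + 1 / 2) * δ) + (y + (t + 1 / 2) * δ)) (x - y + (p - (t + 1 : ℕ) + 1) * δ)
        (by push_cast; ring)]
    exact div_eq_neg_div_neg_mul m0 m1
  · rw [show x + (p + 1 / 2) * δ + -(y + (t + 1 / 2) * δ) - δ
        = x - y + (p - (t + 2 : ℕ) + 1) * δ by push_cast; ring,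
      show x + (p + 1 / 2) * δ + -(y + (t + 1 / 2) * δ)
        = x - y + (p - (t + 1 : ℕ) + 1) * δ by push_cast; ring,
      e1 (-(x + (p + 1 / 2) * δ) + -(y + (t + 1 / 2) * δ) - δ)
        (x + y + (p + (t + 2 : ℕ)) * δ) (by push_cast; ring),
      e1 (-(x + (p + 1 / 2) * δ) + -(y + (t + 1 / 2) * δ))
        (x + y + (p + (t + 1 : ℕ)) * δ) (by push_cast; ring)]
    exact div_eq_neg_div_neg_mul' p2 p1

lemma signedString_succ_of_ne {p s : ℕ} (h : s ≠ p) :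
    signedString δ x (p + 1) s = signedString δ x p s := by
  simp only [signedString, Nat.lt_succ_iff_lt_or_eq, h, or_false]

lemma signedString_succ_self (p : ℕ) : signedString δ x (p + 1) p = x + (p + 1 / 2) * δ := by
  simp [signedString]

lemma signedString_self (p : ℕ) : signedString δ x p p = -(x + (p + 1 / 2) * δ) := by
  simp [signedString]

lemma pairBlock_comm (a b p q : ℕ) : pairBlock f δ x y a b p q = pairBlock f δ y x b a q p := by
  unfold pairBlock
  rw [prod_comm]
  refine prod_congr rfl fun s _ => prod_congr rfl fun t _ => ?_
  rw [add_comm]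

lemma IsBracket.pairTerm_comm (hf : IsBracket f) (a b p q : ℕ) :
    pairTerm f δ x y a b p q = pairTerm f δ y x b a q p := by
  unfold pairTerm
  rw [add_comm (x + p * δ), hf.sub_comm (x + p * δ), hf.sub_comm x, add_comm x y,
    mul_comm (shiftedRatio f δ x y b p), mul_neg, mul_neg, neg_div_neg_eq]

/-- Both `pairBlock` and `pairTerm` acquire the boundary factor of `IsBracket.prod_flip` when `p`
grows by one; cross-multiplication avoids dividing by either. -/
lemma IsBracket.pairBlock_succ (hf : IsBracket f) (hp : ∀ r : ℤ, f (x + y + r * δ) ≠ 0)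
    (hm : ∀ r : ℤ, f (x - y + r * δ) ≠ 0) {a b p q : ℕ} (hpa : p < a) (hqb : q ≤ b) :
    pairBlock f δ x y a b (p + 1) q * pairTerm f δ x y a b p q
      = pairBlock f δ x y a b p q * pairTerm f δ x y a b (p + 1) q := by
  have h1 : pairTerm f δ x y a b (p + 1) q = pairTerm f δ x y a b p q
      * (f (x + y + p * δ) / f (x - y + (p + 1) * δ)
        * (f (x - y + (p - q + 1) * δ) / f (x + y + (p + q) * δ))
        * (f (x + y + (p + q + 1) * δ) / f (x - y + (p - q) * δ)
          * (f (x - y + (p - b) * δ) / f (x + y + (p + b + 1) * δ)))) := by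
    have n1 : f (x + y + (p + q) * δ) ≠ 0 := ne_zero_of_eq_add hp (p + q) (by push_cast; ring)
    have n2 : f (x - y + (p - q) * δ) ≠ 0 := ne_zero_of_eq_add hm (p - q) (by push_cast; ring)
    unfold pairTerm
    rw [shiftedRatio_succ,
      show x + (p + 1 : ℕ) * δ + (y + q * δ) = x + y + (p + q + 1) * δ by push_cast; ring,
      show x + (p + 1 : ℕ) * δ - (y + q * δ) = x - y + (p - q + 1) * δ by push_cast; ring,
      show x + p * δ + (y + q * δ) = x + y + (p + q) * δ by ring,
      show x + p * δ - (y + q * δ) = x - y + (p - q) * δ by ring,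
      show x - y - b * δ + p * δ = x - y + (p - b) * δ by ring,
      show x + y + (b + 1) * δ + p * δ = x + y + (p + b + 1) * δ by ring,
      show x - y + δ + p * δ = x - y + (p + 1) * δ by ring]
    have key : ∀ A B C D E F G H I Q R : ℂ, C ≠ 0 → D ≠ 0 →
        A * B / E * (Q * (F * G / (H * I)) * R)
          = C * D / E * (Q * R) * (F / I * (B / C) * (A / D * (G / H))) := by
      intros
      field_simp
    exact key _ _ _ _ _ _ _ _ _ _ _ n1 n2
  have h2 := hf.prod_flip hp hm p hqb
  have h3 := mul_prod_erase (range a) (fun s => ∏ t ∈ range b,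
    f (signedString δ x p s + signedString δ y q t - δ)
      / f (signedString δ x p s + signedString δ y q t)) (mem_range.mpr hpa)
  have h4 := mul_prod_erase (range a) (fun s => ∏ t ∈ range b,
    f (signedString δ x (p + 1) s + signedString δ y q t - δ)
      / f (signedString δ x (p + 1) s + signedString δ y q t)) (mem_range.mpr hpa)
  have h5 : ∀ s ∈ (range a).erase p, ∏ t ∈ range b,
      f (signedString δ x (p + 1) s + signedString δ y q t - δ)
        / f (signedString δ x (p + 1) s + signedString δ y q t) = ∏ t ∈ range b,
      f (signedString δ x p s + signedString δ y q t - δ)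
        / f (signedString δ x p s + signedString δ y q t) := fun s hs => by
    rw [signedString_succ_of_ne (ne_of_mem_erase hs)]
  rw [prod_congr rfl h5] at h4
  simp only [signedString_succ_self, signedString_self] at h3 h4
  rw [h2] at h4
  rw [h1]
  unfold pairBlock
  rw [← h3, ← h4]
  ring

lemma IsBracket.pairTerm_ne_zero (hf : IsBracket f) (hp : ∀ r : ℤ, f (x + y + r * δ) ≠ 0)
    (hm : ∀ r : ℤ, f (x - y + r * δ) ≠ 0) (a b p q : ℕ) : pairTerm f δ x y a b p q ≠ 0 := by
  have hp' : ∀ r : ℤ, f (y + x + r * δ) ≠ 0 := by simpa only [add_comm y x] using hp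
  have hm' : ∀ r : ℤ, f (y - x + r * δ) ≠ 0 := fun r => by
    rw [show y - x + r * δ = -(x - y + (-r : ℤ) * δ) by push_cast; ring, hf.odd]
    exact neg_ne_zero.mpr (hm _)
  have n1 : f (x + p * δ + (y + q * δ)) ≠ 0 := ne_zero_of_eq_add hp (p + q) (by push_cast; ring)
  have n2 : f (x + p * δ - (y + q * δ)) ≠ 0 := ne_zero_of_eq_add hm (p - q) (by push_cast; ring)
  have n3 : f (x + y) ≠ 0 := ne_zero_of_eq_add hp 0 (by simp)
  have n4 : f (x - y) ≠ 0 := ne_zero_of_eq_add hm 0 (by simp)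
  refine mul_ne_zero (div_ne_zero (mul_ne_zero n1 n2) (mul_ne_zero n3 n4)) (mul_ne_zero ?_ ?_)
  · exact div_ne_zero
      (mul_ne_zero (shiftedFactorial_ne_zero hp 0 (by simp) p)
        (shiftedFactorial_ne_zero hm (-b) (by push_cast; ring) p))
      (mul_ne_zero (shiftedFactorial_ne_zero hp (b + 1) (by push_cast; ring) p)
        (shiftedFactorial_ne_zero hm 1 (by push_cast; ring) p))
  · exact div_ne_zero
      (mul_ne_zero (shiftedFactorial_ne_zero hp' 0 (by simp) q)
        (shiftedFactorial_ne_zero hm' (-a) (by push_cast; ring) q))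
      (mul_ne_zero (shiftedFactorial_ne_zero hp' (a + 1) (by push_cast; ring) q)
        (shiftedFactorial_ne_zero hm' 1 (by push_cast; ring) q))

lemma IsBracket.pairBlock_mul_pairTerm_zero (hf : IsBracket f)
    (hp : ∀ r : ℤ, f (x + y + r * δ) ≠ 0)
    (hm : ∀ r : ℤ, f (x - y + r * δ) ≠ 0) {a b p q : ℕ} (hpa : p ≤ a) (hqb : q ≤ b) :
    pairBlock f δ x y a b p q * pairTerm f δ x y a b 0 q
      = pairBlock f δ x y a b 0 q * pairTerm f δ x y a b p q := by
  induction p with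
  | zero => rfl
  | succ p ih =>
    have h1 := ih (by omega)
    have h2 := hf.pairBlock_succ hp hm (Nat.lt_of_succ_le hpa) hqb
    have h3 := hf.pairTerm_ne_zero hp hm a b p q
    refine mul_right_cancel₀ h3 ?_
    rw [mul_right_comm, h2, mul_right_comm, h1, mul_right_comm]

/-- First `p` is lowered to `0` at fixed `q`, then `q` is lowered by the symmetry that exchanges the
two strings. -/
lemma IsBracket.pairBlock_eq (hf : IsBracket f) (hp : ∀ r : ℤ, f (x + y + r * δ) ≠ 0)
    (hm : ∀ r : ℤ, f (x - y + r * δ) ≠ 0) {a b p q : ℕ} (hpa : p ≤ a) (hqb : q ≤ b) :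
    pairBlock f δ x y a b p q = pairBlock f δ x y a b 0 0 * pairTerm f δ x y a b p q := by
  have hp' : ∀ r : ℤ, f (y + x + r * δ) ≠ 0 := by simpa only [add_comm y x] using hp
  have hm' : ∀ r : ℤ, f (y - x + r * δ) ≠ 0 := fun r => by
    rw [show y - x + r * δ = -(x - y + (-r : ℤ) * δ) by push_cast; ring, hf.odd]
    exact neg_ne_zero.mpr (hm _)
  have h1 := hf.pairBlock_mul_pairTerm_zero hp hm hpa hqb
  have h2 := hf.pairBlock_mul_pairTerm_zero hp' hm' hqb a.zero_le
  have h0 : pairTerm f δ x y a b 0 0 = 1 := by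
    have n3 : f (x + y) ≠ 0 := ne_zero_of_eq_add hp 0 (by simp)
    have n4 : f (x - y) ≠ 0 := ne_zero_of_eq_add hm 0 (by simp)
    simp [pairTerm, n3, n4]
  rw [pairBlock_comm b a q 0, pairBlock_comm b a 0 0, hf.pairTerm_comm b a 0 0,
    hf.pairTerm_comm b a q 0, h0, mul_one] at h2
  refine mul_right_cancel₀ (hf.pairTerm_ne_zero hp hm a b 0 q) ?_
  rw [h1, h2]
  ring

/-! ### Pairs of points within one string. -/

/-- The product of all factors of a term of `Phi` which involve only one index `i`, up to the
parameters. -/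
noncomputable def diagTerm (f : ℂ → ℂ) (δ x : ℂ) (a p : ℕ) : ℂ :=
  f (2 * x + 2 * p * δ) / f (2 * x) * shiftedRatio f δ x x a p

/-- With the factor `t = p` erased, neither telescoping product meets `h (p + 1)`. In the
application that value has denominator `[0]`, hence the exception in `hne`. -/
lemma prod_range_erase_ite_div {h : ℕ → ℂ} {p a : ℕ} (hne : ∀ t, t ≠ p + 1 → h t ≠ 0)
    (hpa : p < a) :
    ∏ t ∈ (range a).erase p, (if t < p then h t / h (t + 1) else h (t + 1) / h (t + 2))
      = h 0 / h p * (h (p + 2) / h (a + 1)) := by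
  have hle : p + 1 ≤ a := hpa
  clear hpa
  induction a, hle using Nat.le_induction with
  | base =>
    rw [range_add_one, erase_insert (by simp),
      prod_congr rfl fun t ht => if_pos (mem_range.mp ht),
      prod_range_div_succ' fun t _ => hne t (by omega), div_self (hne _ (by omega)), mul_one]
  | succ a hpa ih =>
    rw [range_add_one, erase_insert_of_ne (by omega), prod_insert (by simp), ih,
      if_neg (by omega)]
    have := hne (a + 1) (by omega)
    field_simp

lemma IsBracket.prod_flip_self (hf : IsBracket f) (hδ : ∀ k : ℤ, k ≠ 0 → f (k * δ) ≠ 0)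
    (hp : ∀ r : ℤ, f (x + x + r * δ) ≠ 0) {a p : ℕ} (hpa : p < a) :
    ∏ t ∈ (range a).erase p, (f (signedString δ x p t + (x + (p + 1 / 2) * δ) - δ)
        / f (signedString δ x p t + (x + (p + 1 / 2) * δ)))
      = (∏ t ∈ (range a).erase p, (f (signedString δ x p t + -(x + (p + 1 / 2) * δ) - δ)
        / f (signedString δ x p t + -(x + (p + 1 / 2) * δ))))
      * (f (x + x + p * δ) / f ((p + 1) * δ)
        * (f δ / f (x + x + (p + p) * δ))
        * (f (x + x + (p + p + 2) * δ) / f (-δ)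
          * (f ((p - a) * δ) / f (x + x + (p + a + 1) * δ)))) := by
  set h : ℕ → ℂ := fun t => f (x + x + (p + t) * δ) / f ((p - t + 1) * δ) with hh
  have hp' : ∀ t : ℕ, f (x + x + (p + t) * δ) ≠ 0 := fun t =>
    ne_zero_of_eq_add hp (p + t) (by push_cast; ring)
  have hm' : ∀ t : ℕ, t ≠ p + 1 → f ((p - t + 1) * δ) ≠ 0 := fun t ht => by
    have := hδ (p - t + 1) (by omega)
    push_cast at this
    exact this
  have hne : ∀ t, t ≠ p + 1 → h t ≠ 0 := fun t ht => div_ne_zero (hp' t) (hm' t ht)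
  have hR : (f (x + x + p * δ) / f ((p + 1) * δ)
        * (f δ / f (x + x + (p + p) * δ))
        * (f (x + x + (p + p + 2) * δ) / f (-δ)
          * (f ((p - a) * δ) / f (x + x + (p + a + 1) * δ))))
      = h 0 / h p * (h (p + 2) / h (a + 1)) := by
    have e1 : ((p : ℂ) - (p + 2 : ℕ) + 1) * δ = -δ := by push_cast; ring
    have e2 : ((p : ℂ) - p + 1) * δ = δ := by ring
    have e3 : ((p : ℂ) - (a + 1 : ℕ) + 1) * δ = (p - a) * δ := by push_cast; ring
    simp only [hh, div_div_eq_mul_div, e1, e2, e3]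
    simp only [Nat.cast_zero, sub_zero, add_zero, Nat.cast_add, Nat.cast_ofNat, Nat.cast_one,
      add_assoc]
    simp only [div_eq_mul_inv]
    ring
  rw [hR, ← prod_range_erase_ite_div hne hpa, ← prod_mul_distrib]
  refine prod_congr rfl fun t ht => ?_
  have htp := ne_of_mem_erase ht
  have e1 : ∀ u v : ℂ, u = -v → f u = -f v := fun u v h => by rw [h, hf.odd]
  have p0 := hp' t
  have p1 := hp' (t + 1)
  have p2 := hp' (t + 2)
  have m1 := hm' (t + 1) (by omega)
  unfold signedString
  split_ifs with htq
  · have m0 := hm' t (by omega)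
    rw [show x + (t + 1 / 2) * δ + (x + (p + 1 / 2) * δ) - δ = x + x + (p + t) * δ by ring,
      show x + (t + 1 / 2) * δ + (x + (p + 1 / 2) * δ) = x + x + (p + (t + 1 : ℕ)) * δ by
        push_cast; ring,
      e1 (x + (t + 1 / 2) * δ + -(x + (p + 1 / 2) * δ) - δ) ((p - t + 1) * δ) (by ring),
      e1 (x + (t + 1 / 2) * δ + -(x + (p + 1 / 2) * δ)) ((p - (t + 1 : ℕ) + 1) * δ)
        (by push_cast; ring)]
    exact div_eq_neg_div_neg_mul m0 m1
  · have m2 := hm' (t + 2) (by omega)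
    rw [show -(x + (t + 1 / 2) * δ) + (x + (p + 1 / 2) * δ) - δ
        = (p - (t + 2 : ℕ) + 1) * δ by push_cast; ring,
      show -(x + (t + 1 / 2) * δ) + (x + (p + 1 / 2) * δ)
        = (p - (t + 1 : ℕ) + 1) * δ by push_cast; ring,
      e1 (-(x + (t + 1 / 2) * δ) + -(x + (p + 1 / 2) * δ) - δ)
        (x + x + (p + (t + 2 : ℕ)) * δ) (by push_cast; ring),
      e1 (-(x + (t + 1 / 2) * δ) + -(x + (p + 1 / 2) * δ))
        (x + x + (p + (t + 1 : ℕ)) * δ) (by push_cast; ring)]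
    exact div_eq_neg_div_neg_mul' p2 p1

/-- Each flip contributes `[δ]/[-δ] = -1` besides the change of `diagTerm`. The resulting `(-1)^p`
will cancel the signs of the source identity. -/
lemma IsBracket.pairProd_range_eq (hf : IsBracket f) (hδ : ∀ k : ℤ, k ≠ 0 → f (k * δ) ≠ 0)
    (hp : ∀ r : ℤ, f (x + x + r * δ) ≠ 0) {a p : ℕ} (hpa : p ≤ a) :
    pairProd f δ (range a) (signedString δ x p)
      = pairProd f δ (range a) (signedString δ x 0) * ((-1) ^ p * diagTerm f δ x a p) := by
  induction p with
  | zero =>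
    have : f (2 * x) ≠ 0 := ne_zero_of_eq_add hp 0 (by simp [two_mul])
    simp [diagTerm, this]
  | succ p ih =>
    have h1 : diagTerm f δ x a (p + 1) = diagTerm f δ x a p
      * -(f (x + x + p * δ) / f ((p + 1) * δ)
        * (f δ / f (x + x + (p + p) * δ))
        * (f (x + x + (p + p + 2) * δ) / f (-δ)
          * (f ((p - a) * δ) / f (x + x + (p + a + 1) * δ)))) := by
      have n1 : f (x + x + (p + p) * δ) ≠ 0 :=
        ne_zero_of_eq_add hp (p + p) (by push_cast; ring)
      have n2 : f δ ≠ 0 := by simpa using hδ 1 one_ne_zero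
      have n3 : f (2 * x) ≠ 0 := ne_zero_of_eq_add hp 0 (by simp [two_mul])
      unfold diagTerm
      rw [shiftedRatio_succ, hf.odd δ,
        show 2 * x + 2 * (p + 1 : ℕ) * δ = x + x + (p + p + 2) * δ by push_cast; ring,
        show 2 * x + 2 * p * δ = x + x + (p + p) * δ by ring,
        show x - x - a * δ + p * δ = (p - a) * δ by ring,
        show x + x + (a + 1) * δ + p * δ = x + x + (p + a + 1) * δ by ring,
        show x - x + δ + p * δ = (p + 1) * δ by ring]
      have key : ∀ A C D E F G H I Q : ℂ, C ≠ 0 → D ≠ 0 →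
          A / E * (Q * (F * G / (H * I)))
            = C / E * Q * -(F / I * (D / C) * (A / -D * (G / H))) := by
        intros
        field_simp
      exact key _ _ _ _ _ _ _ _ _ n1 n2
    have hmem : p ∈ range a := mem_range.mpr hpa
    have h2 : pairProd f δ ((range a).erase p) (signedString δ x (p + 1))
        = pairProd f δ ((range a).erase p) (signedString δ x p) :=
      pairProd_congr _ fun s hs => signedString_succ_of_ne (ne_of_mem_erase hs)
    have h3 : ∀ z, pairProd f δ (range a) z = pairProd f δ ((range a).erase p) z
        * ∏ b ∈ (range a).erase p, f (z b + z p - δ) / f (z b + z p) := fun z => by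
      rw [← pairProd_insert _ (notMem_erase p _), insert_erase hmem]
    have h4 : pairProd f δ (range a) (signedString δ x (p + 1))
        = pairProd f δ (range a) (signedString δ x p)
        * (f (x + x + p * δ) / f ((p + 1) * δ)
        * (f δ / f (x + x + (p + p) * δ))
        * (f (x + x + (p + p + 2) * δ) / f (-δ)
          * (f ((p - a) * δ) / f (x + x + (p + a + 1) * δ)))) := by
      rw [h3, h3, h2, mul_assoc, signedString_self, ← hf.prod_flip_self hδ hp hpa,
        signedString_succ_self]
      congr 1
      refine prod_congr rfl fun s hs => ?_
      rw [signedString_succ_of_ne (ne_of_mem_erase hs)]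
    rw [h4, ih (by omega), h1, pow_succ]
    ring

/-! ### Interaction with the parameters. -/

/-- The product of the factors of a term of `Phi` which involve the paired parameters of
index `k`. -/
noncomputable def crossTerm (f : ℂ → ℂ) (δ x y : ℂ) (b p : ℕ) : ℂ :=
  shiftedFactorial f δ (x + (δ / 2 + y + b * δ)) p
      / shiftedFactorial f δ (x - (δ / 2 + y + b * δ) + δ) p
    * (shiftedFactorial f δ (x + (δ / 2 - y)) p / shiftedFactorial f δ (x - (δ / 2 - y) + δ) p)

/-- The product of `[z + δ/2 ± w]` over the points of a signed string and of an unsigned one. -/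
noncomputable def crossBlock (f : ℂ → ℂ) (δ x y : ℂ) (a b p : ℕ) : ℂ :=
  ∏ s ∈ range a, ∏ t ∈ range b,
    f (signedString δ x p s + δ / 2 + (y + (t + 1 / 2) * δ))
      * f (signedString δ x p s + δ / 2 - (y + (t + 1 / 2) * δ))

/-- Flipping a point multiplies the block by a product telescoping along the `y`-string. Only its
two ends survive, which is why the parameters of `Phi` come in pairs `δ/2 + y + bδ`, `δ/2 - y`. -/
lemma IsBracket.crossBlock_eq (hf : IsBracket f)
    (hp : ∀ r : ℤ, f (x + y + δ / 2 + r * δ) ≠ 0)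
    (hm : ∀ r : ℤ, f (x - y + δ / 2 + r * δ) ≠ 0) {a p : ℕ} (b : ℕ) (hpa : p ≤ a) :
    crossBlock f δ x y a b p = crossBlock f δ x y a b 0 * crossTerm f δ x y b p := by
  induction p with
  | zero => simp [crossTerm]
  | succ p ih =>
    set l : ℕ → ℂ := fun t => f (x + y + (p + t + 1 / 2) * δ) / f (x - y + (p - t + 1 / 2) * δ)
      with hl
    have hp' : ∀ t : ℕ, f (x + y + (p + t + 1 / 2) * δ) ≠ 0 := fun t =>
      ne_zero_of_eq_add hp (p + t) (by push_cast; ring)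
    have hm' : ∀ t : ℕ, f (x - y + (p - t + 1 / 2) * δ) ≠ 0 := fun t =>
      ne_zero_of_eq_add hm (p - t) (by push_cast; ring)
    have hne : ∀ t, l t ≠ 0 := fun t => div_ne_zero (hp' t) (hm' t)
    have h1 : crossTerm f δ x y b (p + 1) = crossTerm f δ x y b p * (l b / l 0) := by
      have n1 := hp' b
      have n2 := hp' 0
      have n3 := hm' b
      have n4 := hm' 0
      unfold crossTerm
      simp only [shiftedFactorial_succ, hl]
      rw [show x + (δ / 2 + y + b * δ) + p * δ = x + y + (p + b + 1 / 2) * δ by ring,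
        show x - (δ / 2 + y + b * δ) + δ + p * δ = x - y + (p - b + 1 / 2) * δ by ring,
        show x + (δ / 2 - y) + p * δ = x - y + (p - (0 : ℕ) + 1 / 2) * δ by push_cast; ring,
        show x - (δ / 2 - y) + δ + p * δ = x + y + (p + (0 : ℕ) + 1 / 2) * δ by push_cast; ring]
      field_simp
    have h2 : ∏ t ∈ range b, f (x + (p + 1 / 2) * δ + δ / 2 + (y + (t + 1 / 2) * δ))
          * f (x + (p + 1 / 2) * δ + δ / 2 - (y + (t + 1 / 2) * δ))
        = (∏ t ∈ range b, f (-(x + (p + 1 / 2) * δ) + δ / 2 + (y + (t + 1 / 2) * δ))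
          * f (-(x + (p + 1 / 2) * δ) + δ / 2 - (y + (t + 1 / 2) * δ))) * (l b / l 0) := by
      rw [← prod_range_div_succ hne, ← prod_mul_distrib]
      refine prod_congr rfl fun t _ => ?_
      have e1 : ∀ u v : ℂ, u = -v → f u = -f v := fun u v h => by rw [h, hf.odd]
      have n1 := hp' t
      have n2 := hp' (t + 1)
      have n3 := hm' t
      have n4 := hm' (t + 1)
      rw [show x + (p + 1 / 2) * δ + δ / 2 + (y + (t + 1 / 2) * δ)
          = x + y + (p + (t + 1 : ℕ) + 1 / 2) * δ by push_cast; ring,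
        show x + (p + 1 / 2) * δ + δ / 2 - (y + (t + 1 / 2) * δ)
          = x - y + (p - t + 1 / 2) * δ by ring,
        e1 (-(x + (p + 1 / 2) * δ) + δ / 2 + (y + (t + 1 / 2) * δ))
          (x - y + (p - (t + 1 : ℕ) + 1 / 2) * δ) (by push_cast; ring),
        e1 (-(x + (p + 1 / 2) * δ) + δ / 2 - (y + (t + 1 / 2) * δ))
          (x + y + (p + t + 1 / 2) * δ) (by ring)]
      exact mul_eq_neg_mul_neg_mul n4 n1
    have hmem : p ∈ range a := mem_range.mpr hpa
    have h3 : crossBlock f δ x y a b (p + 1) = crossBlock f δ x y a b p * (l b / l 0) := by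
      unfold crossBlock
      rw [← mul_prod_erase _ _ hmem, ← mul_prod_erase _ _ hmem, signedString_succ_self,
        signedString_self, h2, mul_right_comm]
      refine congrArg₂ _ (congrArg₂ _ rfl (prod_congr rfl fun s hs => ?_)) rfl
      rw [signedString_succ_of_ne (ne_of_mem_erase hs)]
    rw [h3, ih (by omega), h1]
    ring

end

/-! ### Assembling the strings: the theorem at generic points. -/

/-- The indices `(i, s)` with `s < α i`, in lexicographic order. -/
def strings {m : ℕ} (α : Fin m → ℕ) : Finset (Fin m ×ₗ ℕ) :=
  (univ.sigma fun i => range (α i)).map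
    ⟨fun p => toLex (p.1, p.2), fun p q h => by
      have h' : (p.1, p.2) = (q.1, q.2) := toLex.injective h
      exact Sigma.ext (congrArg Prod.fst h') (heq_of_eq (congrArg Prod.snd h'))⟩

/-- The point `x_i + (s + 1/2) δ` of index `(i, s)`. -/
noncomputable def stringPoint (δ : ℂ) {m : ℕ} (x : Fin m → ℂ) (a : Fin m ×ₗ ℕ) : ℂ :=
  x (ofLex a).1 + ((ofLex a).2 + 1 / 2) * δ

section

variable {f : ℂ → ℂ} {δ : ℂ} {m n : ℕ}

lemma mem_strings {α : Fin m → ℕ} {a : Fin m ×ₗ ℕ} :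
    a ∈ strings α ↔ (ofLex a).2 < α (ofLex a).1 := by
  simp only [strings, mem_map, mem_sigma, mem_univ, true_and, mem_range]
  constructor
  · rintro ⟨p, hp, rfl⟩
    exact hp
  · intro h
    exact ⟨⟨(ofLex a).1, (ofLex a).2⟩, h, rfl⟩

lemma prod_strings (α : Fin m → ℕ) (F : Fin m ×ₗ ℕ → ℂ) :
    ∏ a ∈ strings α, F a = ∏ i, ∏ s ∈ range (α i), F (toLex (i, s)) := by
  rw [strings, prod_map, prod_sigma]
  rfl

lemma card_strings (α : Fin m → ℕ) : (strings α).card = ∑ i, α i := by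
  simp [strings]

lemma signed_stringPoint_strings (x : Fin m → ℂ) (μ : Fin m → ℕ) (i : Fin m) (s : ℕ) :
    signed (stringPoint δ x) (strings μ) (toLex (i, s)) = signedString δ (x i) (μ i) s := by
  simp [signed, signedString, mem_strings, stringPoint]

/-- In lexicographic order a pair `a < b` lies either within one string or in strings `i < j`. -/
lemma pairProd_strings (α : Fin m → ℕ) (z : Fin m ×ₗ ℕ → ℂ) :
    pairProd f δ (strings α) z
      = (∏ i, pairProd f δ (range (α i)) fun s => z (toLex (i, s)))
        * ∏ i, ∏ j ∈ Ioi i, ∏ s ∈ range (α i), ∏ t ∈ range (α j),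
          f (z (toLex (i, s)) + z (toLex (j, t)) - δ) / f (z (toLex (i, s)) + z (toLex (j, t))) := by
  have h : ∀ i s, ∏ b ∈ strings α with toLex (i, s) < b,
      f (z (toLex (i, s)) + z b - δ) / f (z (toLex (i, s)) + z b)
      = (∏ t ∈ range (α i) with s < t,
          f (z (toLex (i, s)) + z (toLex (i, t)) - δ) / f (z (toLex (i, s)) + z (toLex (i, t))))
        * ∏ j ∈ Ioi i, ∏ t ∈ range (α j),
          f (z (toLex (i, s)) + z (toLex (j, t)) - δ)
            / f (z (toLex (i, s)) + z (toLex (j, t))) := by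
    intro i s
    rw [prod_filter, prod_strings]
    have h1 : ∀ j : Fin m, (∏ t ∈ range (α j), if toLex (i, s) < toLex (j, t) then
        f (z (toLex (i, s)) + z (toLex (j, t)) - δ) / f (z (toLex (i, s)) + z (toLex (j, t))) else 1)
        = (if i = j then (∏ t ∈ range (α j) with s < t,
          f (z (toLex (i, s)) + z (toLex (j, t)) - δ) / f (z (toLex (i, s)) + z (toLex (j, t))))
          else 1)
        * if i < j then ∏ t ∈ range (α j),
          f (z (toLex (i, s)) + z (toLex (j, t)) - δ)
            / f (z (toLex (i, s)) + z (toLex (j, t))) else 1 := by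
      intro j
      rcases lt_trichotomy i j with hij | rfl | hij
      · simp [Prod.Lex.toLex_lt_toLex, hij, hij.ne]
      · rw [if_pos rfl, if_neg (lt_irrefl i), mul_one, prod_filter]
        simp only [Prod.Lex.toLex_lt_toLex, lt_irrefl, true_and, false_or]
      · simp [Prod.Lex.toLex_lt_toLex, hij.not_gt, hij.ne']
    rw [prod_congr rfl fun j _ => h1 j, prod_mul_distrib, prod_ite_eq, if_pos (mem_univ i),
      ← prod_filter]
    congr 2
    ext j
    simp
  rw [pairProd, prod_strings, ← prod_mul_distrib]
  refine prod_congr rfl fun i _ => ?_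
  rw [prod_congr rfl fun s _ => h i s, prod_mul_distrib, prod_comm (s := range (α i))]
  rfl

lemma pairProd_strings_signed (x : Fin m → ℂ) (α μ : Fin m → ℕ) :
    pairProd f δ (strings α) (signed (stringPoint δ x) (strings μ))
      = (∏ i, pairProd f δ (range (α i)) (signedString δ (x i) (μ i)))
        * ∏ i, ∏ j ∈ Ioi i, pairBlock f δ (x i) (x j) (α i) (α j) (μ i) (μ j) := by
  rw [pairProd_strings]
  simp only [signed_stringPoint_strings]
  rfl

lemma crossProd_strings_signed (x : Fin m → ℂ) (y : Fin n → ℂ) (α μ : Fin m → ℕ)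
    (β : Fin n → ℕ) :
    crossProd f δ (strings α) ((strings β).val.map (stringPoint δ y))
        (signed (stringPoint δ x) (strings μ))
      = ∏ i, ∏ k, crossBlock f δ (x i) (y k) (α i) (β k) (μ i) := by
  rw [crossProd, prod_strings]
  refine prod_congr rfl fun i _ => ?_
  have h : ∀ s, (((strings β).val.map (stringPoint δ y)).map fun y =>
      f (signed (stringPoint δ x) (strings μ) (toLex (i, s)) + δ / 2 + y)
        * f (signed (stringPoint δ x) (strings μ) (toLex (i, s)) + δ / 2 - y)).prod
      = ∏ k, ∏ t ∈ range (β k),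
        f (signedString δ (x i) (μ i) s + δ / 2 + (y k + (t + 1 / 2) * δ))
        * f (signedString δ (x i) (μ i) s + δ / 2 - (y k + (t + 1 / 2) * δ)) := by
    intro s
    rw [Multiset.map_map, signed_stringPoint_strings]
    exact prod_strings β _
  rw [prod_congr rfl fun s _ => h s, prod_comm]
  rfl

/-- The term of `Phi` of index `μ`, its factors grouped by the variables they involve. -/
lemma Phi_pairedParams (α : Fin m → ℕ) (β : Fin n → ℕ) (x : Fin m → ℂ) (y : Fin n → ℂ) :
    Phi f δ α x (pairedParams δ β y) = ∑ μ ∈ Icc 0 α,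
      (∏ i, diagTerm f δ (x i) (α i) (μ i))
        * (∏ i, ∏ j ∈ Ioi i, pairTerm f δ (x i) (x j) (α i) (α j) (μ i) (μ j))
        * ∏ i, ∏ k, crossTerm f δ (x i) (y k) (β k) (μ i) := by
  refine sum_congr rfl fun μ _ => ?_
  have h1 : ∏ i, ∏ j,
        (shiftedFactorial f δ (x i + x j) (μ i)
            * shiftedFactorial f δ (x i - x j - α j * δ) (μ i))
          / (shiftedFactorial f δ (x i + x j + (α j + 1) * δ) (μ i)
            * shiftedFactorial f δ (x i - x j + δ) (μ i))
      = (∏ i, shiftedRatio f δ (x i) (x i) (α i) (μ i))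
        * ∏ i, ∏ j ∈ Ioi i, (shiftedRatio f δ (x i) (x j) (α j) (μ i)
          * shiftedRatio f δ (x j) (x i) (α i) (μ j)) := by
    have h2 := prod_prod_Ioi_mul_eq_prod_prod_off_diag
      (fun i j => shiftedRatio f δ (x j) (x i) (α i) (μ j))
    rw [h2, ← prod_mul_distrib]
    exact prod_congr rfl fun i _ => Fintype.prod_eq_mul_prod_compl i
      fun j => shiftedRatio f δ (x i) (x j) (α j) (μ i)
  have h3 : ∀ i, ∏ k, shiftedFactorial f δ (x i + pairedParams δ β y k) (μ i)
        / shiftedFactorial f δ (x i - pairedParams δ β y k + δ) (μ i)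
      = ∏ k, crossTerm f δ (x i) (y k) (β k) (μ i) := by
    intro i
    rw [Fintype.prod_sum_type, ← prod_mul_distrib]
    rfl
  rw [h1, prod_congr rfl fun i _ => h3 i]
  simp only [diagTerm, pairTerm, prod_mul_distrib]
  ring

/-- A set of indices which is not of the form `strings μ` contributes `0` to the source identity,
since it contains some `(i, s + 1)` without `(i, s)`. -/
lemma IsBracket.exists_eq_strings (hf : IsBracket f) (α : Fin m → ℕ) (x : Fin m → ℂ)
    {A : Finset (Fin m ×ₗ ℕ)} (hA : A ⊆ strings α)
    (hne : pairProd f δ (strings α) (signed (stringPoint δ x) A) ≠ 0) :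
    ∃ μ ∈ Icc 0 α, strings μ = A := by
  have hstep : ∀ i s, toLex (i, s + 1) ∈ A → toLex (i, s) ∈ A := by
    intro i s hs
    by_contra hns
    have hlt : s + 1 < α i := mem_strings.mp (hA hs)
    refine hne (prod_eq_zero (i := toLex (i, s)) (mem_strings.mpr (Nat.lt_of_succ_lt hlt))
      (prod_eq_zero (i := toLex (i, s + 1)) (mem_filter.mpr ⟨hA hs, ?_⟩) ?_))
    · rw [Prod.Lex.toLex_lt_toLex]
      exact Or.inr ⟨rfl, Nat.lt_succ_self s⟩
    -- Consecutive points of a string differ by `δ`, so the signs `-`, `+` on them annihilate a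
    -- numerator.
    · have : signed (stringPoint δ x) A (toLex (i, s))
          + signed (stringPoint δ x) A (toLex (i, s + 1)) - δ = 0 := by
        simp only [signed, hs, hns, if_true, if_false, stringPoint, ofLex_toLex]
        push_cast
        ring
      rw [this, hf.map_zero, zero_div]
  classical
  -- `μ_i` is the first index missing from `A` in string `i`; by `hstep` no later one belongs to
  -- `A`.
  have hex : ∀ i, ∃ s, toLex (i, s) ∉ A := fun i =>
    ⟨α i, fun h => lt_irrefl _ (mem_strings.mp (hA h))⟩
  refine ⟨fun i => Nat.find (hex i), mem_Icc.mpr ⟨fun i => Nat.zero_le _, fun i => ?_⟩, ?_⟩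
  · exact Nat.find_min' (hex i) fun h => lt_irrefl _ (mem_strings.mp (hA h))
  · ext a
    rw [mem_strings]
    constructor
    · intro h
      exact not_not.mp (Nat.find_min (hex _) h)
    · intro h
      by_contra hlt
      rw [not_lt] at hlt
      have hdown : ∀ d s, toLex ((ofLex a).1, s + d) ∈ A → toLex ((ofLex a).1, s) ∈ A := by
        intro d
        induction d with
        | zero => exact fun s hs => hs
        | succ d ih => exact fun s hs => ih s (hstep _ _ hs)
      refine Nat.find_spec (hex (ofLex a).1) (hdown ((ofLex a).2 - Nat.find (hex (ofLex a).1)) _ ?_)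
      rw [Nat.add_sub_cancel' hlt]
      exact h

lemma strings_injective : Function.Injective (strings : (Fin m → ℕ) → _) := by
  intro μ ν h
  have key : ∀ {μ ν : Fin m → ℕ}, strings μ = strings ν → ∀ i, μ i ≤ ν i := by
    intro μ ν h i
    by_contra hlt
    rw [not_le] at hlt
    have : toLex (i, ν i) ∈ strings μ := mem_strings.mpr hlt
    rw [h, mem_strings] at this
    exact lt_irrefl _ this
  exact funext fun i => le_antisymm (key h i) (key h.symm i)

theorem IsBracket.Phi_eq_zero_of_generic (hf : IsBracket f)
    (hδ : ∀ k : ℤ, k ≠ 0 → f (k * δ) ≠ 0) (α : Fin m → ℕ) (β : Fin n → ℕ)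
    (hαβ : ∑ i, α i = ∑ k, β k + 1) (x : Fin m → ℂ) (y : Fin n → ℂ)
    (hp : ∀ i j, ∀ r : ℤ, f (x i + x j + r * δ) ≠ 0)
    (hm : ∀ i j, i ≠ j → ∀ r : ℤ, f (x i - x j + r * δ) ≠ 0)
    (hyp : ∀ i k, ∀ r : ℤ, f (x i + y k + δ / 2 + r * δ) ≠ 0)
    (hym : ∀ i k, ∀ r : ℤ, f (x i - y k + δ / 2 + r * δ) ≠ 0) :
    Phi f δ α x (pairedParams δ β y) = 0 := by
  set X := stringPoint δ x with hX
  set Y := (strings β).val.map (stringPoint δ y) with hY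
  have hsum : ∑ A ∈ (strings α).powerset, (-1) ^ A.card
      * (pairProd f δ (strings α) (signed X A) * crossProd f δ (strings α) Y (signed X A)) = 0 := by
    refine hf.sum_powerset_pairProd_mul_crossProd X Y (strings α) ?_ ?_ ?_ ?_ ?_
    · rw [card_strings, hαβ, hY, Multiset.card_map, card_val, card_strings]
    · intro a _ b _
      exact ne_zero_of_eq_add (hp (ofLex a).1 (ofLex b).1) ((ofLex a).2 + (ofLex b).2 + 1)
        (by simp only [hX, stringPoint]; push_cast; ring)
    · intro a _ b _ hab
      by_cases h : (ofLex a).1 = (ofLex b).1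
      · have h2 : (ofLex a).2 ≠ (ofLex b).2 := fun h2 => hab (ofLex.injective (Prod.ext h h2))
        have := hδ ((ofLex a).2 - (ofLex b).2) (by omega)
        simp only [hX, stringPoint, h]
        convert this using 2
        push_cast
        ring
      · exact ne_zero_of_eq_add (hm _ _ h) ((ofLex a).2 - (ofLex b).2)
          (by simp only [hX, stringPoint]; push_cast; ring)
    · intro a _ b _
      exact ne_zero_of_eq_add (hp (ofLex a).1 (ofLex b).1) ((ofLex a).2 + (ofLex b).2 + 2)
        (by simp only [hX, stringPoint]; push_cast; ring)
    · intro a _ b _ hab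
      by_cases h : (ofLex b).1 = (ofLex a).1
      · have h2 : (ofLex a).2 ≤ (ofLex b).2 := by
          rcases Prod.Lex.le_iff.mp hab with h3 | h3
          · exact absurd h h3.ne'
          · exact h3.2
        have := hδ ((ofLex b).2 - (ofLex a).2 + 1) (by omega)
        simp only [hX, stringPoint, h]
        convert this using 2
        push_cast
        ring
      · exact ne_zero_of_eq_add (hm _ _ h) ((ofLex b).2 - (ofLex a).2 + 1)
          (by simp only [hX, stringPoint]; push_cast; ring)
  -- Every surviving term is the term `μ = 0` times the corresponding term of `Phi`, the two signs
  -- `(-1)^|μ|` cancelling.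
  have hterm : ∀ μ ∈ Icc 0 α, (-1) ^ (strings μ).card
      * (pairProd f δ (strings α) (signed X (strings μ))
        * crossProd f δ (strings α) Y (signed X (strings μ)))
      = (pairProd f δ (strings α) (signed X (strings 0))
        * crossProd f δ (strings α) Y (signed X (strings 0)))
      * ((∏ i, diagTerm f δ (x i) (α i) (μ i))
        * (∏ i, ∏ j ∈ Ioi i, pairTerm f δ (x i) (x j) (α i) (α j) (μ i) (μ j))
        * ∏ i, ∏ k, crossTerm f δ (x i) (y k) (β k) (μ i)) := by
    intro μ hμ
    have hle := (mem_Icc.mp hμ).2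
    rw [hX, hY, pairProd_strings_signed, pairProd_strings_signed, crossProd_strings_signed,
      crossProd_strings_signed, card_strings,
      prod_congr rfl fun i _ => hf.pairProd_range_eq hδ (hp i i) (hle i),
      prod_congr rfl fun i _ => prod_congr rfl fun j hj =>
        hf.pairBlock_eq (hp i j) (hm i j (mem_Ioi.mp hj).ne) (hle i) (hle j),
      prod_congr rfl fun i _ => prod_congr rfl fun k _ =>
        hf.crossBlock_eq (hyp i k) (hym i k) (β k) (hle i)]
    simp only [prod_mul_distrib, prod_pow_eq_pow_sum, Pi.zero_apply]
    have hsq : ((-1 : ℂ) ^ ∑ i, μ i) * (-1) ^ ∑ i, μ i = 1 := by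
      rw [← mul_pow]; simp
    linear_combination (∏ i, pairProd f δ (range (α i)) (signedString δ (x i) 0))
      * (∏ i, diagTerm f δ (x i) (α i) (μ i))
      * (∏ i, ∏ j ∈ Ioi i, pairBlock f δ (x i) (x j) (α i) (α j) 0 0)
      * (∏ i, ∏ j ∈ Ioi i, pairTerm f δ (x i) (x j) (α i) (α j) (μ i) (μ j))
      * (∏ i, ∏ k, crossBlock f δ (x i) (y k) (α i) (β k) 0)
      * (∏ i, ∏ k, crossTerm f δ (x i) (y k) (β k) (μ i)) * hsq
  -- For `μ = 0` all signs are minus, so `pairProd` involves only sums `X_a + X_b`, and genericity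
  -- allows division by this common factor.
  have hzero : pairProd f δ (strings α) (signed X (strings 0))
      * crossProd f δ (strings α) Y (signed X (strings 0)) ≠ 0 := by
    have hs : ∀ a, signed X (strings 0) a = -X a := fun a => by
      simp [signed, mem_strings]
    refine mul_ne_zero (prod_ne_zero_iff.mpr fun a _ => prod_ne_zero_iff.mpr fun b _ => ?_)
      (prod_ne_zero_iff.mpr fun a _ => ?_)
    · rw [hs, hs]
      refine div_ne_zero ?_ ?_
      · rw [show -X a + -X b - δ = -(X a + X b + δ) by ring, hf.odd]
        exact neg_ne_zero.mpr (ne_zero_of_eq_add (hp (ofLex a).1 (ofLex b).1)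
          ((ofLex a).2 + (ofLex b).2 + 2) (by simp only [hX, stringPoint]; push_cast; ring))
      · rw [show -X a + -X b = -(X a + X b) by ring, hf.odd]
        exact neg_ne_zero.mpr (ne_zero_of_eq_add (hp (ofLex a).1 (ofLex b).1)
          ((ofLex a).2 + (ofLex b).2 + 1) (by simp only [hX, stringPoint]; push_cast; ring))
    · rw [hY, Multiset.map_map]
      change ∏ b ∈ strings β, _ ≠ _
      refine prod_ne_zero_iff.mpr fun b _ => ?_
      simp only [Function.comp_apply, hs]
      refine mul_ne_zero ?_ ?_
      · rw [show -X a + δ / 2 + stringPoint δ y b = -(X a - δ / 2 - stringPoint δ y b) by ring,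
          hf.odd]
        exact neg_ne_zero.mpr (ne_zero_of_eq_add (hym (ofLex a).1 (ofLex b).1)
          ((ofLex a).2 - (ofLex b).2 - 1) (by simp only [hX, stringPoint]; push_cast; ring))
      · rw [show -X a + δ / 2 - stringPoint δ y b = -(X a - δ / 2 + stringPoint δ y b) by ring,
          hf.odd]
        exact neg_ne_zero.mpr (ne_zero_of_eq_add (hyp (ofLex a).1 (ofLex b).1)
          ((ofLex a).2 + (ofLex b).2) (by simp only [hX, stringPoint]; push_cast; ring))
  rw [← sum_of_injOn (s := Icc 0 α) (strings : (Fin m → ℕ) → _) strings_injective.injOn ?_ ?_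
    fun μ _ => rfl, sum_congr rfl hterm, ← mul_sum, ← Phi_pairedParams] at hsum
  · exact (mul_eq_zero.mp hsum).resolve_left hzero
  · intro μ hμ
    have hle := (mem_Icc.mp (mem_coe.mp hμ)).2
    exact mem_coe.mpr (mem_powerset.mpr fun a ha =>
      mem_strings.mpr ((mem_strings.mp ha).trans_le (hle _)))
  · intro A hA hnot
    by_cases h0 : pairProd f δ (strings α) (signed X A) = 0
    · rw [h0, zero_mul, mul_zero]
    · obtain ⟨μ, hμ, h⟩ := hf.exists_eq_strings α x (mem_powerset.mp hA) h0
      exact absurd ⟨μ, mem_coe.mpr hμ, h⟩ hnot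

end

/-! ### From generic points to all points by continuity. -/

section
variable {f : ℂ → ℂ} {δ : ℂ} {m n : ℕ}

lemma shiftedFactorial_ne_zero_of_le {u : ℂ} {k l : ℕ} (hkl : k ≤ l)
    (h : shiftedFactorial f δ u l ≠ 0) : shiftedFactorial f δ u k ≠ 0 :=
  prod_ne_zero_iff.mpr fun r hr =>
    prod_ne_zero_iff.mp h r (mem_range.mpr ((mem_range.mp hr).trans_le hkl))

lemma continuous_shiftedFactorial (hf : Continuous f) (k : ℕ) :
    Continuous fun u => shiftedFactorial f δ u k := by
  unfold shiftedFactorial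
  fun_prop

lemma continuousAt_Phi (hf : Continuous f) {κ : Type*} [Fintype κ] (α : Fin m → ℕ)
    (x : Fin m → ℂ) (u : κ → ℂ) (h : PhiDenomsNeZero f δ α x u) :
    ContinuousAt (fun x => Phi f δ α x u) x := by
  have hsf : ∀ k : ℕ, Continuous fun u => shiftedFactorial f δ u k :=
    continuous_shiftedFactorial hf
  refine tendsto_finsetSum _ fun μ hμ => ?_
  have hle := (mem_Icc.mp hμ).2
  refine ((Filter.Tendsto.mul ?_ ?_).mul ?_).mul ?_
  · refine tendsto_finsetProd _ fun i _ => ?_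
    exact ContinuousAt.div (hf.comp (by fun_prop)).continuousAt
      (hf.comp (by fun_prop)).continuousAt (h.two_mul i)
  · refine tendsto_finsetProd _ fun i _ => tendsto_finsetProd _ fun j hj => ?_
    exact ContinuousAt.div
      ((hf.comp (by fun_prop)).mul (hf.comp (by fun_prop))).continuousAt
      ((hf.comp (by fun_prop)).mul (hf.comp (by fun_prop))).continuousAt
      (mul_ne_zero (h.add i j (mem_Ioi.mp hj)) (h.sub i j (mem_Ioi.mp hj)))
  · refine tendsto_finsetProd _ fun i _ => tendsto_finsetProd _ fun j _ => ?_
    exact ContinuousAt.div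
      (((hsf _).comp (by fun_prop)).mul ((hsf _).comp (by fun_prop))).continuousAt
      (((hsf _).comp (by fun_prop)).mul ((hsf _).comp (by fun_prop))).continuousAt
      (mul_ne_zero (shiftedFactorial_ne_zero_of_le (hle i) (h.add_shift i j))
        (shiftedFactorial_ne_zero_of_le (hle i) (h.sub_shift i j)))
  · refine tendsto_finsetProd _ fun i _ => tendsto_finsetProd _ fun k _ => ?_
    exact ContinuousAt.div ((hsf _).comp (by fun_prop)).continuousAt
      ((hsf _).comp (by fun_prop)).continuousAt
      (shiftedFactorial_ne_zero_of_le (hle i) (h.param i k))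

/-- On a suitable line through `x`, a dense set of points is in general position. -/
lemma IsBracket.dense_generic (hf : IsBracket f) (δ : ℂ) (x : Fin m → ℂ) (y : Fin n → ℂ) :
    Dense {t : ℂ | (∀ i j, ∀ r : ℤ, f ((x i + (i + 1) * t) + (x j + (j + 1) * t) + r * δ) ≠ 0)
      ∧ (∀ i j, i ≠ j → ∀ r : ℤ, f ((x i + (i + 1) * t) - (x j + (j + 1) * t) + r * δ) ≠ 0)
      ∧ (∀ i k, ∀ r : ℤ, f ((x i + (i + 1) * t) + y k + δ / 2 + r * δ) ≠ 0)
      ∧ ∀ i k, ∀ r : ℤ, f ((x i + (i + 1) * t) - y k + δ / 2 + r * δ) ≠ 0} := by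
  -- The speeds `i + 1` are positive and distinct, so every bracket argument has a nonzero
  -- coefficient of `t`: a sum of two speeds, a difference of two distinct ones, or a single one.
  have hpos : ∀ i : ℕ, (i + 1 : ℂ) ≠ 0 := fun i => Nat.cast_add_one_ne_zero i
  have key := hf.dense_forall_ne_zero
    (ι := ((Fin m × Fin m) × ℤ) ⊕ ({p : Fin m × Fin m // p.1 ≠ p.2} × ℤ)
      ⊕ ((Fin m × Fin n) × ℤ) ⊕ ((Fin m × Fin n) × ℤ))
    (Sum.elim (fun p => x p.1.1 + x p.1.2 + p.2 * δ)
      (Sum.elim (fun p => x p.1.1.1 - x p.1.1.2 + p.2 * δ)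
        (Sum.elim (fun p => x p.1.1 + y p.1.2 + δ / 2 + p.2 * δ)
          (fun p => x p.1.1 - y p.1.2 + δ / 2 + p.2 * δ))))
    (Sum.elim (fun p => (p.1.1 + 1) + (p.1.2 + 1))
      (Sum.elim (fun p => (p.1.1.1 : ℕ) - (p.1.1.2 : ℕ))
        (Sum.elim (fun p => p.1.1 + 1) (fun p => p.1.1 + 1)))) ?_
  · refine key.mono fun t ht => ⟨fun i j r => ?_, fun i j hij r => ?_, fun i k r => ?_,
      fun i k r => ?_⟩
    · have := ht (Sum.inl ((i, j), r))
      convert this using 2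
      simp only [Sum.elim_inl]
      ring
    · have := ht (Sum.inr (Sum.inl (⟨(i, j), hij⟩, r)))
      convert this using 2
      simp only [Sum.elim_inl, Sum.elim_inr]
      ring
    · have := ht (Sum.inr (Sum.inr (Sum.inl ((i, k), r))))
      convert this using 2
      simp only [Sum.elim_inl, Sum.elim_inr]
      ring
    · have := ht (Sum.inr (Sum.inr (Sum.inr ((i, k), r))))
      convert this using 2
      simp only [Sum.elim_inr]
      ring
  · rintro (p | p | p | p)
    · have := hpos (p.1.1 + p.1.2 + 1)
      simp only [Sum.elim_inl]
      convert this using 1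
      push_cast
      ring
    · simp only [Sum.elim_inl, Sum.elim_inr]
      rw [sub_ne_zero, Ne, Nat.cast_inj]
      exact fun h => p.1.2 (Fin.ext h)
    · exact hpos _
    · exact hpos _

end

theorem mainTheorem11
    (f : ℂ → ℂ) (hf : IsBracket f)
    (δ : ℂ) (hδ : ∀ k : ℤ, k ≠ 0 → f (k * δ) ≠ 0)
    (m n : ℕ) (α : Fin m → ℕ) (β : Fin n → ℕ)
    (hαβ : ∑ i, α i = ∑ k, β k + 1)
    (x : Fin m → ℂ) (y : Fin n → ℂ)
    (hxy : PhiDenomsNeZero f δ α x (pairedParams δ β y)) :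
    Phi f δ α x (pairedParams δ β y) = 0 := by
  have hline : Continuous fun t : ℂ => fun i : Fin m => x i + (i + 1) * t := by fun_prop
  have hline0 : (fun i : Fin m => x i + (i + 1) * (0 : ℂ)) = x := by simp
  have hcont : ContinuousAt
      (fun t : ℂ => Phi f δ α (fun i => x i + (i + 1) * t) (pairedParams δ β y)) 0 := by
    have h := continuousAt_Phi hf.entire.continuous α x (pairedParams δ β y) hxy
    rw [← hline0] at h
    exact ContinuousAt.comp (f := fun t : ℂ => fun i : Fin m => x i + (i + 1) * t) h
      hline.continuousAt
  have hmem := (hf.dense_generic δ x y) 0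
  rw [mem_closure_iff_frequently] at hmem
  by_contra hne
  -- A nonzero value at `t = 0` would persist nearby, where generic `t` with value zero occur.
  have hev := hcont.eventually_ne (y := 0) (by simpa using hne)
  obtain ⟨t, ht, ht0⟩ := (hmem.and_eventually hev).exists
  exact ht0 (hf.Phi_eq_zero_of_generic hδ α β hαβ _ y ht.1 ht.2.1 ht.2.2.1 ht.2.2.2)
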